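/- Let $G=(V,E,\omega)$ be a connected undirected graph with $n=|V|\ge 2$ nodes and positive integer edge weights, the weight of an edge being its length. Let $\omega(u,v)$ be the minimum total weight of a path from $u$ to $v$, let $D_\omega=\max_{u,v}\omega(u,v)$, and let $CC(u)=\frac{n-1}{\sum_{v\in V}\omega(u,v)}$ be the closeness centrality of $u$. The nodes communicate in synchronous rounds. In each round every node may send to each of its neighbours one message, of $O(\log n+\log D_\omega)$ bits if the node identifiers are at most $n^{O(1)}$ (so of $O(\log n)$ bits if, in addition, $D_\omega$ is polynomial in $n$). Initially a node knows only its own identifier, the identifiers of its neighbours and the weights of the edges to them, $n$, the smallest identifier in the network, and the input parameter $\varepsilon\in(0,1]$. For a constant $c>0$, Algorithm $\mathcal A_{CC}$ is the following. Every node joins a set $S$ independently with probability $\min\{1,\frac{c\log n}{n\varepsilon^2}\}$. The nodes then run a distributed $S$-shortest-paths algorithm, after which every node $u$ has halted and knows the distance $\omega(r,u)$ to every $r\in S$ (the nodes of $S$ being given by their identifiers). Finally, every node $u$ outputs $$\widehat{CC}(u)=1\Big/\sum_{r\in S}\frac{n\,\omega(r,u)}{|S|\,(n-1)} .$$ There is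 a distributed $S$-shortest-paths algorithm, the same for all networks, in the above model that for every network and every $S\subseteq V$ takes $O(|S|+D_\omega)$ rounds, and with it $\mathcal A_{CC}$ has the following property. For every $a>0$ there is a $c_0>0$ such that, for every constant $c\ge c_0$, every such network and every $\varepsilon\in(0,1]$, with probability at least $1-n^{-a}$: the set $S$ is non-empty and has $O(\log n/\varepsilon^2)$ elements, all nodes halt after $O\left(\frac{\log n}{\varepsilon^2}+D_\omega\right)$ rounds, and $$\left|\frac1{CC(u)}-\frac1{\widehat{CC}(u)}\right|\le \varepsilon D_\omega\qquad\text{for all }u\in V .$$ The constant in the bound $O(|S|+D_\omega)$ is absolute, the one in the message length depends only on the exponent in the bound on the identifiers, and the others depend only on $a$ and $c$. -/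

import Mathlib

/-- A connected network with positive integer edge weights (the lengths of the edges) and with
pairwise distinct node identifiers. Only the weights of the edges of `graph` matter. -/
structure Network (V : Type*) where
  graph : SimpleGraph V
  weight : Sym2 V → ℕ
  ident : V → ℕ
  connected : graph.Connected
  weight_pos : ∀ e ∈ graph.edgeSet, 0 < weight e
  ident_injective : Function.Injective ident

/-- What a node knows before the first round: the number of nodes, the smallest identifier in the
network, its own identifier, the identifiers of its neighbours paired with the weights of the
connecting edges, and whether it has joined the sample. -/
structure LocalView where
  numNodes : ℕ
  leader : ℕ
  self : ℕ
  nbrs : Finset (ℕ × ℕ)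
  sampled : Bool

/-- A synchronous message passing algorithm. All nodes run the same local program. In each round a
node may send to each neighbour (addressed by its identifier) one message, which is a natural number
written in binary; `none` means that nothing is sent. It then updates its state from the messages
received (indexed by the identifier of the sender). A node has halted once `output` is defined; the
output is a finite table of pairs (identifier, distance). -/
structure CongestAlgorithm where
  State : Type
  init : LocalView → State
  send : State → ℕ → Option ℕ
  receive : State → (ℕ → Option ℕ) → State
  output : State → Option (Finset (ℕ × ℕ))

namespace Network

variable {V : Type*}

/-- The weighted distance: the least total weight of a walk from `u` to `v`. -/
noncomputable def wdist (N : Network V) (u v : V) : ℕ :=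
  sInf {L : ℕ | ∃ p : N.graph.Walk u v, L = (p.edges.map N.weight).sum}

/-- The weighted eccentricity of `u`. -/
noncomputable def wecc [Fintype V] (N : Network V) (u : V) : ℕ :=
  Finset.univ.sup fun v => N.wdist u v

/-- The weighted diameter. -/
noncomputable def wdiam [Fintype V] (N : Network V) : ℕ :=
  Finset.univ.sup fun u => N.wecc u

/-- The closeness centrality of `u`. -/
noncomputable def closeness [Fintype V] (N : Network V) (u : V) : ℝ :=
  ((Fintype.card V : ℝ) - 1) / ∑ v : V, (N.wdist u v : ℝ)

open Classical in
/-- The initial knowledge of `v` when the nodes of `S` have joined the sample. -/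
noncomputable def view [Fintype V] (N : Network V) (S : Finset V) (v : V) : LocalView where
  numNodes := Fintype.card V
  leader := sInf (Set.range N.ident)
  self := N.ident v
  nbrs := (Finset.univ.filter fun u => N.graph.Adj v u).image
    fun u => (N.ident u, N.weight s(v, u))
  sampled := decide (v ∈ S)

/-- The table of the distances from `u` to all nodes of `S`. -/
noncomputable def distTable (N : Network V) (S : Finset V) (u : V) : Finset (ℕ × ℕ) :=
  S.image fun r => (N.ident r, N.wdist r u)

end Network

namespace CongestAlgorithm

variable {V : Type*}

open Classical in
/-- The message that `u` sends to `v` in a round that starts in configuration `σ`. Only neighbours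
can exchange messages, and a node that has halted sends nothing. -/
noncomputable def message (A : CongestAlgorithm) (N : Network V) (σ : V → A.State) (u v : V) :
    Option ℕ :=
  if N.graph.Adj u v ∧ A.output (σ u) = none then A.send (σ u) (N.ident v) else none

open Classical in
/-- One synchronous round. A node that has halted never changes its state again. -/
noncomputable def step (A : CongestAlgorithm) (N : Network V) (σ : V → A.State) : V → A.State :=
  fun v =>
    if A.output (σ v) = none then
      A.receive (σ v) fun i =>
        (Function.partialInv N.ident i).bind fun u => A.message N σ u v
    else σ v

/-- The configuration after `t` rounds, when the nodes of `S` have joined the sample. -/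
noncomputable def config [Fintype V] (A : CongestAlgorithm) (N : Network V) (S : Finset V)
    (t : ℕ) : V → A.State :=
  (A.step N)^[t] fun v => A.init (N.view S v)

end CongestAlgorithm

/-- The probability with which a node joins the sample. -/
noncomputable def joinProb (c : ℝ) (n : ℕ) (ε : ℝ) : ℝ :=
  min 1 (c * Real.log n / (n * ε ^ 2))

open Classical in
/-- The probability that a random subset of `V` has the property `E`, when each element of `V` is
put into the subset independently with probability `p`. -/
noncomputable def sampleProb {V : Type*} [Fintype V] (p : ℝ) (E : Finset V → Prop) : ℝ :=
  ∑ S : Finset V with E S, p ^ S.card * (1 - p) ^ (Fintype.card V - S.card)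

/-- The estimate of the closeness centrality that a node of a network with `n` nodes computes from
its table of distances to the sampled nodes. -/
noncomputable def ccEstimate (n : ℕ) (L : Finset (ℕ × ℕ)) : ℝ :=
  1 / ∑ x ∈ L, ((n : ℝ) * x.2) / (L.card * ((n : ℝ) - 1))

/-! A wave from the leader `l` crosses an edge of weight `w` in `w` rounds, so it reaches `u` in
round `wdist l u`. A node unreached at time `t` raises an alarm `t + 1`, and every node forwards the
largest alarm it has seen. No alarm exceeds the eccentricity of `l`, and by `lt_alarm` every `t`
below it is exceeded everywhere by time `3 * t + 1`. A node whose alarm `A` satisfies `3 * A + 1 ≤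
time` thus knows that `A` is the eccentricity and that all distances are at most `2 * A`.

Meanwhile each node sends its table entry `(r, d)` in the round `d + rank`. The order by distance is
compatible with shortest paths (`trueRank_le_of_adj`), so the correct entry is present by time
`wdist r u + trueRank` (`mem_cands`). A node that knows `k` sources at a time beyond `2 * A + k`
therefore knows them all. Both tests first succeed at the same time at every node, so all nodes halt
together and halting never disturbs the others.

For the estimate, `1/CC - 1/ĈC` is, up to sign, `n/(n-1)` times the average over `S` of the
distances minus their mean over `V`. Centring absorbs the randomness of `|S|` in the numerator. A
second-order exponential moment bound and a union bound over `2n + 2` events show that `|S|` is at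
least half its expectation and that every centred sum is small. -/

namespace Network

variable {V : Type*} (N : Network V)

/-! ### Weighted distances -/

theorem wdist_le {u v : V} (p : N.graph.Walk u v) :
    N.wdist u v ≤ (p.edges.map N.weight).sum :=
  Nat.sInf_le ⟨p, rfl⟩

theorem exists_walk_wdist (u v : V) :
    ∃ p : N.graph.Walk u v, N.wdist u v = (p.edges.map N.weight).sum := by
  obtain ⟨p⟩ := N.connected.preconnected u v
  exact Nat.sInf_mem (s := {L : ℕ | ∃ p : N.graph.Walk u v, L = (p.edges.map N.weight).sum})
    ⟨_, p, rfl⟩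

@[simp] theorem wdist_self (u : V) : N.wdist u u = 0 := by
  simpa using N.wdist_le (SimpleGraph.Walk.nil : N.graph.Walk u u)

theorem wdist_comm (u v : V) : N.wdist u v = N.wdist v u := by
  have key : ∀ u v, N.wdist u v ≤ N.wdist v u := fun u v => by
    obtain ⟨p, hp⟩ := N.exists_walk_wdist v u
    simpa [hp, SimpleGraph.Walk.edges_reverse, List.sum_reverse] using N.wdist_le p.reverse
  exact le_antisymm (key u v) (key v u)

theorem wdist_triangle (u v w : V) : N.wdist u w ≤ N.wdist u v + N.wdist v w := by
  obtain ⟨p, hp⟩ := N.exists_walk_wdist u v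
  obtain ⟨q, hq⟩ := N.exists_walk_wdist v w
  simpa [hp, hq, SimpleGraph.Walk.edges_append] using N.wdist_le (p.append q)

theorem wdist_le_weight {u v : V} (h : N.graph.Adj u v) : N.wdist u v ≤ N.weight s(u, v) := by
  simpa using N.wdist_le h.toWalk

theorem wdist_le_add_weight (r : V) {u v : V} (h : N.graph.Adj v u) :
    N.wdist r u ≤ N.wdist r v + N.weight s(v, u) :=
  (N.wdist_triangle r v u).trans (Nat.add_le_add_left (N.wdist_le_weight h) _)

theorem weight_pos_of_adj {u v : V} (h : N.graph.Adj u v) : 0 < N.weight s(u, v) :=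
  N.weight_pos _ h

/-- The last edge of a shortest path. Since weights are positive, `v` is strictly closer to `r`,
which drives every induction along shortest paths below. -/
theorem exists_adj_wdist_add_weight {r u : V} (h : r ≠ u) :
    ∃ v, N.graph.Adj v u ∧ N.wdist r v + N.weight s(v, u) = N.wdist r u := by
  obtain ⟨p, hp⟩ := N.exists_walk_wdist u r
  cases p with
  | nil => exact absurd rfl h
  | @cons _ v _ hadj q =>
    refine ⟨v, hadj.symm, le_antisymm ?_ (N.wdist_le_add_weight r hadj.symm)⟩
    have hq := N.wdist_le q
    rw [N.wdist_comm r v, N.wdist_comm r u, hp, Sym2.eq_swap]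
    simp only [SimpleGraph.Walk.edges_cons, List.map_cons, List.sum_cons]
    omega

theorem wdist_eq_zero_iff {r u : V} : N.wdist r u = 0 ↔ r = u := by
  refine ⟨fun h => ?_, fun h => by simp [h]⟩
  by_contra hne
  obtain ⟨v, hv, e⟩ := N.exists_adj_wdist_add_weight hne
  have := N.weight_pos_of_adj hv
  omega

theorem exists_leader [Nonempty V] : ∃ l, N.ident l = sInf (Set.range N.ident) :=
  Nat.sInf_mem (Set.range_nonempty N.ident)

theorem card_distTable (S : Finset V) (u : V) : (N.distTable S u).card = S.card :=
  Finset.card_image_of_injective _ fun _ _ h => N.ident_injective (Prod.ext_iff.1 h).1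

theorem sum_distTable (S : Finset V) (u : V) (f : ℕ × ℕ → ℝ) :
    ∑ x ∈ N.distTable S u, f x = ∑ r ∈ S, f (N.ident r, N.wdist r u) :=
  Finset.sum_image fun _ _ _ _ h => N.ident_injective (Prod.ext_iff.1 h).1

section Fintype

variable [Fintype V]

theorem wdist_le_wecc (u v : V) : N.wdist u v ≤ N.wecc u :=
  Finset.le_sup (f := fun v => N.wdist u v) (Finset.mem_univ v)

theorem wecc_le_wdiam (u : V) : N.wecc u ≤ N.wdiam :=
  Finset.le_sup (f := fun u => N.wecc u) (Finset.mem_univ u)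

theorem wdist_le_wdiam (u v : V) : N.wdist u v ≤ N.wdiam :=
  (N.wdist_le_wecc u v).trans (N.wecc_le_wdiam u)

theorem wdist_le_two_mul_wecc (l u v : V) : N.wdist u v ≤ 2 * N.wecc l := by
  have h := N.wdist_triangle u l v
  have h1 := N.wdist_le_wecc l u
  have h2 := N.wdist_le_wecc l v
  rw [N.wdist_comm u l] at h
  omega

theorem wdiam_pos (h : 2 ≤ Fintype.card V) : 0 < N.wdiam := by
  obtain ⟨u, v, huv⟩ := Fintype.exists_pair_of_one_lt_card h
  have h0 := mt N.wdist_eq_zero_iff.1 huv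
  have := N.wdist_le_wdiam u v
  omega

theorem exists_wdist_eq_wecc (l : V) : ∃ x, N.wdist l x = N.wecc l := by
  obtain ⟨x, -, hx⟩ := Finset.exists_mem_eq_sup Finset.univ ⟨l, Finset.mem_univ l⟩
    (fun v => N.wdist l v)
  exact ⟨x, hx.symm⟩

/-- An edge that leaves the ball of radius `t` around `l`. -/
theorem exists_adj_of_lt_wecc {l : V} {t : ℕ} (h : t < N.wecc l) :
    ∃ x y, N.graph.Adj x y ∧ N.wdist l y ≤ t ∧ t < N.wdist l x := by
  classical
  obtain ⟨z, hz⟩ := N.exists_wdist_eq_wecc l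
  -- A nearest node outside the ball has its predecessor on a shortest path inside.
  obtain ⟨x, hx, hmin⟩ := Finset.exists_min_image (Finset.univ.filter fun x => t < N.wdist l x)
    (fun x => N.wdist l x) ⟨z, by simp [hz, h]⟩
  simp only [Finset.mem_filter, Finset.mem_univ, true_and] at hx hmin
  have hne : l ≠ x := by
    rintro rfl
    simp at hx
  obtain ⟨y, hy, e⟩ := N.exists_adj_wdist_add_weight hne
  refine ⟨x, y, hy.symm, ?_, hx⟩
  by_contra hlt
  have := hmin y (by omega)
  have := N.weight_pos_of_adj hy
  omega

theorem mem_view_nbrs {S : Finset V} {v : V} {p : ℕ × ℕ} :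
    p ∈ (N.view S v).nbrs ↔ ∃ u, N.graph.Adj v u ∧ (N.ident u, N.weight s(v, u)) = p := by
  simp [view]

end Fintype

end Network

/-- The state of a node in the distributed shortest paths algorithm. `cands` holds the candidates
(identifier, distance) for the distances to the sampled nodes; `arrivals` holds the times at which
the wave that starts at the leader and travels at unit speed arrives; `alarm` is the latest time
stamp sent by a node that the wave had not reached. -/
structure WaveState where
  view : LocalView
  time : ℕ
  cands : Finset (ℕ × ℕ)
  arrivals : Finset ℕ
  alarm : ℕ

/-! ### The local program -/

namespace WaveState

def start (L : LocalView) : WaveState where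
  view := L
  time := 0
  cands := if L.sampled then {(L.self, 0)} else ∅
  arrivals := if L.self = L.leader then {0} else ∅
  alarm := 0

/-- The wave has arrived. -/
def Reached (s : WaveState) : Prop :=
  ∃ a ∈ s.arrivals, a ≤ s.time

open Classical in
/-- The alarm that the node sends: its own, if the wave has not arrived yet. -/
noncomputable def sentAlarm (s : WaveState) : ℕ :=
  -- Being unreached at time `t` means distance at least `t + 1` from the leader.
  if s.Reached then s.alarm else max s.alarm (s.time + 1)

/-- The current distance estimates: the least candidate for each identifier. -/
def table (s : WaveState) : Finset (ℕ × ℕ) :=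
  s.cands.filter fun x => ∀ y ∈ s.cands, y.1 = x.1 → x.2 ≤ y.2

/-- Table entries are ordered by distance, then by identifier. -/
def key (x : ℕ × ℕ) : ℕ ×ₗ ℕ :=
  toLex (x.2, x.1)

/-- A table entry counts itself, so its rank is at least 1. -/
def rank (s : WaveState) (x : ℕ × ℕ) : ℕ :=
  (s.table.filter fun y => key y ≤ key x).card

/-- The entries whose turn to be sent it is; there is at most one. -/
def due (s : WaveState) : Finset (ℕ × ℕ) :=
  s.table.filter fun x => x.2 + s.rank x = s.time

open Classical in
noncomputable def sentEntry (s : WaveState) : Option (ℕ × ℕ) :=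
  if h : s.due.Nonempty then some h.choose else none

open Classical in
noncomputable def msg (s : WaveState) : Bool × ℕ × Option (ℕ × ℕ) :=
  (decide s.Reached, s.sentAlarm, s.sentEntry)

/-- Reached nodes announce themselves in every round. The repetitions are harmless, because
`Reached` depends only on the least arrival. -/
noncomputable def next (s : WaveState) (inbox : ℕ → Option (Bool × ℕ × Option (ℕ × ℕ))) :
    WaveState where
  view := s.view
  time := s.time + 1
  cands := s.cands ∪ s.view.nbrs.biUnion fun p =>
    ((inbox p.1).bind fun m => m.2.2).toFinset.image fun x => (x.1, x.2 + p.2)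
  arrivals := s.arrivals ∪ (s.view.nbrs.filter fun p =>
    (inbox p.1).map Prod.fst = some true).image fun p => s.time + p.2
  alarm := max s.sentAlarm (s.view.nbrs.sup fun p => ((inbox p.1).map fun m => m.2.1).getD 0)

/-- The first test certifies that the alarm is the eccentricity of the leader, the second that no
source is missing. -/
def result (s : WaveState) : Option (Finset (ℕ × ℕ)) :=
  if 3 * s.alarm + 1 ≤ s.time ∧ 2 * s.alarm + (s.cands.image Prod.fst).card < s.time then
    some s.table
  else none

theorem key_injective : Function.Injective key := fun _ _ h =>
  Prod.ext (congrArg (fun z => (ofLex z).2) h) (congrArg (fun z => (ofLex z).1) h)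

theorem snd_le_of_key_le {x y : ℕ × ℕ} (h : key x ≤ key y) : x.2 ≤ y.2 := by
  rcases Prod.Lex.le_iff.1 h with h | h
  · exact le_of_lt h
  · exact le_of_eq h.1

theorem key_le_of_snd_le {i a b : ℕ} (h : a ≤ b) : key (i, a) ≤ key (i, b) := by
  rcases h.lt_or_eq with h | h
  · exact Prod.Lex.le_iff.2 (Or.inl h)
  · exact h ▸ le_rfl

/-- Adding `w` to the larger distance and at most `w` to the smaller one preserves the order. -/
theorem key_le_add {i j a b c w : ℕ} (h : key (i, a) ≤ key (j, b)) (hc : c ≤ a + w) :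
    key (i, c) ≤ key (j, b + w) := by
  have h1 : key (i, a + w) ≤ key (j, b + w) := by
    rcases Prod.Lex.le_iff.1 h with h | h
    · exact Prod.Lex.le_iff.2 (Or.inl (Nat.add_lt_add_right h w))
    · exact Prod.Lex.le_iff.2 (Or.inr ⟨congrArg (· + w) h.1, h.2⟩)
  exact (key_le_of_snd_le hc).trans h1

theorem rank_lt_rank {s : WaveState} {x y : ℕ × ℕ} (hy : y ∈ s.table) (h : key x < key y) :
    s.rank x < s.rank y := by
  refine Finset.card_lt_card (Finset.ssubset_iff_subset_ne.2 ⟨fun z hz => ?_, fun e => ?_⟩)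
  · rw [Finset.mem_filter] at hz ⊢
    exact ⟨hz.1, hz.2.trans h.le⟩
  · have : y ∈ s.table.filter fun z => key z ≤ key x := e ▸ Finset.mem_filter.2 ⟨hy, le_rfl⟩
    exact absurd (Finset.mem_filter.1 this).2 (not_le.2 h)

/-- Distance plus rank strictly increases along the order of the table, so two entries never share a
round and one entry per message suffices. -/
theorem due_subsingleton {s : WaveState} {x y : ℕ × ℕ} (hx : x ∈ s.due) (hy : y ∈ s.due) :
    x = y := by
  rw [due, Finset.mem_filter] at hx hy
  rcases lt_trichotomy (key x) (key y) with h | h | h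
  · have := rank_lt_rank hy.1 h
    have := snd_le_of_key_le h.le
    omega
  · exact key_injective h
  · have := rank_lt_rank hx.1 h
    have := snd_le_of_key_le h.le
    omega

theorem sentEntry_eq {s : WaveState} {x : ℕ × ℕ} (hx : x ∈ s.due) : s.sentEntry = some x := by
  have h : s.due.Nonempty := ⟨x, hx⟩
  rw [sentEntry, dif_pos h, due_subsingleton h.choose_spec hx]

theorem mem_due_of_sentEntry {s : WaveState} {x : ℕ × ℕ} (hx : s.sentEntry = some x) :
    x ∈ s.due := by
  rw [sentEntry] at hx
  split_ifs at hx with h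
  exact Option.some.inj hx ▸ h.choose_spec

theorem alarm_le_sentAlarm (s : WaveState) : s.alarm ≤ s.sentAlarm := by
  unfold sentAlarm
  split_ifs <;> simp

end WaveState

/-- Shortest paths to the sampled nodes by pipelining, with a wave from the leader that measures
the eccentricity of the leader. -/
noncomputable def waveAlgorithm : CongestAlgorithm where
  State := WaveState
  init := WaveState.start
  send s _ := some (Encodable.encode s.msg)
  receive s f := s.next fun i => (f i).bind Encodable.decode
  output := WaveState.result

/-! ### The run without halting -/

namespace Network

open WaveState

variable {V : Type*} [Fintype V] (N : Network V) (S : Finset V)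

open Classical in
/-- The configurations of the algorithm when no node ever halts. -/
noncomputable def run : ℕ → V → WaveState
  | 0, v => start (N.view S v)
  | t + 1, v => (run t v).next fun i => (Function.partialInv N.ident i).bind fun u =>
      if N.graph.Adj u v then some (run t u).msg else none

variable {N S}

/-- Until some node halts, the halting rule has no effect and decoding undoes encoding. -/
theorem config_eq_run {T : ℕ} (h : ∀ t < T, ∀ v, (N.run S t v).result = none) :
    ∀ t ≤ T, waveAlgorithm.config N S t = N.run S t := by
  intro t
  induction t with
  | zero => exact fun _ => rfl
  | succ t ih =>
    intro ht
    have e : waveAlgorithm.config N S (t + 1) =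
        waveAlgorithm.step N (waveAlgorithm.config N S t) :=
      Function.iterate_succ_apply' _ _ _
    have hn : ∀ v, waveAlgorithm.output (N.run S t v) = none := h t ht
    rw [e, ih (by omega)]
    funext v
    have hstep : waveAlgorithm.step N (N.run S t) v = (N.run S t v).next fun i =>
        ((Function.partialInv N.ident i).bind fun u =>
          waveAlgorithm.message N (N.run S t) u v).bind Encodable.decode := if_pos (hn v)
    rw [hstep, run]
    congr 1
    funext i
    rcases Function.partialInv N.ident i with - | u
    · rfl
    · by_cases hadj : N.graph.Adj u v
      · have hm : waveAlgorithm.message N (N.run S t) u v =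
            some (Encodable.encode (N.run S t u).msg) := if_pos ⟨hadj, hn u⟩
        simp only [Option.bind_some, hm, hadj, if_true, Encodable.encodek]
      · have hm : waveAlgorithm.message N (N.run S t) u v = none := if_neg fun h => hadj h.1
        simp [hm, hadj]

@[simp] theorem run_view (t : ℕ) (v : V) : (N.run S t v).view = N.view S v := by
  induction t with
  | zero => rfl
  | succ t ih => exact ih

@[simp] theorem run_time (t : ℕ) (v : V) : (N.run S t v).time = t := by
  induction t with
  | zero => rfl
  | succ t ih => exact congrArg (· + 1) ih

open Classical in
theorem inbox_ident {u v : V} (t : ℕ) (h : N.graph.Adj v u) :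
    ((Function.partialInv N.ident (N.ident u)).bind fun u =>
      if N.graph.Adj u v then some (N.run S t u).msg else none) = some (N.run S t u).msg := by
  rw [Function.partialInv_left N.ident_injective]
  simp [h.symm]

theorem mem_cands_succ {t : ℕ} {v : V} {x : ℕ × ℕ} :
    x ∈ (N.run S (t + 1) v).cands ↔ x ∈ (N.run S t v).cands ∨
      ∃ u, N.graph.Adj u v ∧ ∃ y, (N.run S t u).sentEntry = some y ∧
        (y.1, y.2 + N.weight s(u, v)) = x := by
  rw [run, next]
  simp only [Finset.mem_union, Finset.mem_biUnion, run_view, mem_view_nbrs]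
  refine or_congr Iff.rfl ⟨?_, ?_⟩
  · rintro ⟨_, ⟨u, hu, rfl⟩, hx⟩
    rw [inbox_ident t hu] at hx
    refine ⟨u, hu.symm, ?_⟩
    simpa [msg, Sym2.eq_swap] using hx
  · rintro ⟨u, hu, y, hy, rfl⟩
    refine ⟨_, ⟨u, hu.symm, rfl⟩, ?_⟩
    rw [inbox_ident t hu.symm]
    simp [msg, hy, Sym2.eq_swap]

theorem mem_arrivals_succ {t a : ℕ} {v : V} :
    a ∈ (N.run S (t + 1) v).arrivals ↔ a ∈ (N.run S t v).arrivals ∨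
      ∃ u, N.graph.Adj u v ∧ (N.run S t u).Reached ∧ t + N.weight s(u, v) = a := by
  rw [run, next]
  simp only [Finset.mem_union, Finset.mem_image, Finset.mem_filter, run_view, mem_view_nbrs,
    run_time]
  refine or_congr Iff.rfl ⟨?_, ?_⟩
  · rintro ⟨_, ⟨⟨u, hu, rfl⟩, hx⟩, rfl⟩
    rw [inbox_ident t hu] at hx
    refine ⟨u, hu.symm, ?_, by simp [Sym2.eq_swap]⟩
    simpa [msg] using hx
  · rintro ⟨u, hu, hr, rfl⟩
    refine ⟨_, ⟨⟨u, hu.symm, rfl⟩, ?_⟩, by simp [Sym2.eq_swap]⟩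
    rw [inbox_ident t hu.symm]
    simpa [msg] using hr

theorem alarm_succ_le_iff {t a : ℕ} {v : V} :
    (N.run S (t + 1) v).alarm ≤ a ↔ (N.run S t v).sentAlarm ≤ a ∧
      ∀ u, N.graph.Adj u v → (N.run S t u).sentAlarm ≤ a := by
  rw [run, next]
  simp only [max_le_iff, Finset.sup_le_iff, run_view, mem_view_nbrs]
  refine and_congr Iff.rfl ⟨fun h u hu => ?_, ?_⟩
  · have := h _ ⟨u, hu.symm, rfl⟩
    rw [inbox_ident t hu.symm] at this
    simpa [msg] using this
  · rintro h _ ⟨u, hu, rfl⟩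
    rw [inbox_ident t hu]
    simpa [msg] using h u hu.symm

/-! ### The wave from the leader -/

section Wave

variable {l : V} (hl : N.ident l = sInf (Set.range N.ident))

include hl

theorem zero_mem_arrivals (t : ℕ) : 0 ∈ (N.run S t l).arrivals := by
  induction t with
  | zero => simp [run, start, view, hl]
  | succ t ih => exact mem_arrivals_succ.2 (Or.inl ih)

theorem wdist_le_of_mem_arrivals (t : ℕ) : ∀ (u : V) (a : ℕ),
    a ∈ (N.run S t u).arrivals → N.wdist l u ≤ a := by
  induction t with
  | zero =>
    intro u a ha
    have hu : l = u := by
      by_contra hne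
      have : N.ident u ≠ sInf (Set.range N.ident) := fun e =>
        hne (N.ident_injective (hl.trans e.symm))
      simp [run, start, view, this] at ha
    simp [hu]
  | succ t ih =>
    intro u a ha
    rcases mem_arrivals_succ.1 ha with ha | ⟨v, hv, ⟨b, hb, hbt⟩, rfl⟩
    · exact ih u a ha
    · have h1 := ih v b hb
      have h2 := N.wdist_le_add_weight l hv
      rw [run_time] at hbt
      omega

theorem add_weight_mem_arrivals (t : ℕ) {u v : V} (h : N.graph.Adj v u) (ht : N.wdist l v < t) :
    N.wdist l v + N.weight s(v, u) ∈ (N.run S t u).arrivals := by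
  induction t generalizing u v with
  | zero => omega
  | succ t ih =>
    rcases Nat.lt_or_ge (N.wdist l v) t with hv | hv
    · exact mem_arrivals_succ.2 (Or.inl (ih h hv))
    -- This is the round in which `v` is first reached; its announcement yields exactly the arrival
    -- time `t + w`.
    · have e : N.wdist l v = t := by omega
      refine mem_arrivals_succ.2 (Or.inr ⟨v, h, ?_, by rw [e]⟩)
      rcases eq_or_ne l v with rfl | hne
      · exact ⟨0, zero_mem_arrivals hl t, Nat.zero_le _⟩
      · obtain ⟨w, hw, e'⟩ := N.exists_adj_wdist_add_weight hne
        have := N.weight_pos_of_adj hw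
        exact ⟨_, ih hw (by omega), by rw [e', e, run_time]⟩

theorem reached_iff (t : ℕ) (u : V) : (N.run S t u).Reached ↔ N.wdist l u ≤ t := by
  refine ⟨fun ⟨a, ha, hat⟩ => ?_, fun h => ?_⟩
  · rw [run_time] at hat
    exact (wdist_le_of_mem_arrivals hl t u a ha).trans hat
  · rcases eq_or_ne l u with rfl | hne
    · exact ⟨0, zero_mem_arrivals hl t, Nat.zero_le _⟩
    · obtain ⟨w, hw, e⟩ := N.exists_adj_wdist_add_weight hne
      have := N.weight_pos_of_adj hw
      exact ⟨_, add_weight_mem_arrivals hl t hw (by omega), by rw [e, run_time]; exact h⟩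

theorem sentAlarm_le_of_alarm_le {t : ℕ} {u : V} (h : (N.run S t u).alarm ≤ N.wecc l) :
    (N.run S t u).sentAlarm ≤ N.wecc l := by
  unfold sentAlarm
  split_ifs with hr
  · exact h
  · rw [reached_iff hl, not_le] at hr
    rw [run_time]
    exact max_le h (hr.trans_le (N.wdist_le_wecc l u))

theorem alarm_le_wecc (t : ℕ) (u : V) : (N.run S t u).alarm ≤ N.wecc l := by
  induction t generalizing u with
  | zero => exact Nat.zero_le _
  | succ t ih =>
    exact alarm_succ_le_iff.2 ⟨sentAlarm_le_of_alarm_le hl (ih u),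
      fun v _ => sentAlarm_le_of_alarm_le hl (ih v)⟩

theorem sentAlarm_le_wecc (t : ℕ) (u : V) : (N.run S t u).sentAlarm ≤ N.wecc l :=
  sentAlarm_le_of_alarm_le hl (alarm_le_wecc hl t u)

omit hl in
theorem sentAlarm_le_alarm_succ (t : ℕ) (u : V) :
    (N.run S t u).sentAlarm ≤ (N.run S (t + 1) u).alarm :=
  (alarm_succ_le_iff.1 le_rfl).1

omit hl in
theorem sentAlarm_le_alarm_succ_of_adj (t : ℕ) {u v : V} (h : N.graph.Adj u v) :
    (N.run S t u).sentAlarm ≤ (N.run S (t + 1) v).alarm :=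
  (alarm_succ_le_iff.1 le_rfl).2 u h

omit hl in
theorem alarm_mono (u : V) : Monotone fun t => (N.run S t u).alarm :=
  monotone_nat_of_le_succ fun t =>
    (alarm_le_sentAlarm _).trans (sentAlarm_le_alarm_succ t u)

omit hl in
-- Alarms move one hop per round, whatever the weight, and a shortest path has at most `wdist u v`
-- edges.
theorem alarm_le_alarm_add_wdist (t : ℕ) (u v : V) :
    (N.run S t u).alarm ≤ (N.run S (t + N.wdist u v) v).alarm := by
  induction hd : N.wdist u v using Nat.strong_induction_on generalizing v with
  | _ d ih =>
    rcases eq_or_ne u v with rfl | hne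
    · exact alarm_mono u (Nat.le_add_right _ _)
    · obtain ⟨w, hw, e⟩ := N.exists_adj_wdist_add_weight hne
      have hpos := N.weight_pos_of_adj hw
      refine (ih (N.wdist u w) (by omega) w rfl).trans ((alarm_le_sentAlarm _).trans
        ((sentAlarm_le_alarm_succ_of_adj _ hw).trans (alarm_mono v ?_)))
      omega

/-- Some edge leaves the ball of radius `t` around `l`. Its outer end sends `t + 1` in round `t`;
one round brings it to the inner end, at most `t` more to `l`, and at most `t` more to any `u`
inside the ball. A node outside the ball raises the alarm itself. -/
theorem lt_alarm {t s : ℕ} (ht : t < N.wecc l) (hs : 3 * t + 1 ≤ s) (u : V) :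
    t < (N.run S s u).alarm := by
  have hsent : ∀ x, t < N.wdist l x → t < (N.run S t x).sentAlarm := fun x hx => by
    rw [sentAlarm, if_neg (by rw [reached_iff hl]; omega), run_time]
    exact lt_max_of_lt_right (Nat.lt_succ_self t)
  rcases Nat.lt_or_ge t (N.wdist l u) with hu | hu
  · exact (hsent u hu).trans_le ((sentAlarm_le_alarm_succ t u).trans (alarm_mono u (by omega)))
  · obtain ⟨x, y, hxy, hy, hx⟩ := N.exists_adj_of_lt_wecc ht
    refine (hsent x hx).trans_le ((sentAlarm_le_alarm_succ_of_adj t hxy).trans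
      ((alarm_le_alarm_add_wdist (t + 1) y l).trans
        ((alarm_le_alarm_add_wdist _ l u).trans (alarm_mono u ?_))))
    rw [N.wdist_comm y l]
    omega

theorem alarm_eq_wecc {s : ℕ} (hs : 3 * N.wecc l + 1 ≤ s) (u : V) :
    (N.run S s u).alarm = N.wecc l := by
  refine le_antisymm (alarm_le_wecc hl s u) ?_
  rcases Nat.eq_zero_or_pos (N.wecc l) with h | h
  · omega
  · have := lt_alarm hl (S := S) (t := N.wecc l - 1) (s := s) (by omega) (by omega) u
    omega

theorem alarm_eq_wecc_of_le {s : ℕ} {u : V} (hs : 3 * (N.run S s u).alarm + 1 ≤ s) :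
    (N.run S s u).alarm = N.wecc l := by
  refine le_antisymm (alarm_le_wecc hl s u) (not_lt.1 fun h => ?_)
  exact lt_irrefl _ (lt_alarm hl h hs u)

end Wave

/-! ### Pipelined distances to the sample -/

section Pipeline

variable (N S) in
/-- The position of `r` in the list of sampled nodes, ordered by distance to `u`. -/
noncomputable def trueRank (u r : V) : ℕ :=
  (S.filter fun r' => key (N.ident r', N.wdist r' u) ≤ key (N.ident r, N.wdist r u)).card

/-- Candidates are lengths of actual walks, so they never underestimate. -/
theorem exists_of_mem_cands (t : ℕ) (u : V) {x : ℕ × ℕ} (hx : x ∈ (N.run S t u).cands) :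
    ∃ r ∈ S, N.ident r = x.1 ∧ N.wdist r u ≤ x.2 := by
  induction t generalizing u x with
  | zero =>
    by_cases hu : u ∈ S
    · have : x = (N.ident u, 0) := by simpa [run, start, view, hu] using hx
      exact ⟨u, hu, by simp [this]⟩
    · simp [run, start, view, hu] at hx
  | succ t ih =>
    rcases mem_cands_succ.1 hx with hx | ⟨v, hv, y, hy, rfl⟩
    · exact ih u hx
    · obtain ⟨r, hr, e, hle⟩ := ih v (Finset.mem_filter.1
        (Finset.mem_filter.1 (mem_due_of_sentEntry hy)).1).1
      exact ⟨r, hr, e, (N.wdist_le_add_weight r hv).trans (Nat.add_le_add_right hle _)⟩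

theorem mem_table_of_mem_cands {t : ℕ} {u r : V}
    (h : (N.ident r, N.wdist r u) ∈ (N.run S t u).cands) :
    (N.ident r, N.wdist r u) ∈ (N.run S t u).table := by
  refine Finset.mem_filter.2 ⟨h, fun y hy e => ?_⟩
  obtain ⟨r', -, e', hle⟩ := exists_of_mem_cands t u hy
  obtain rfl := N.ident_injective (e'.trans e)
  exact hle

theorem eq_of_mem_table {t : ℕ} {u r : V} {y : ℕ × ℕ} (hy : y ∈ (N.run S t u).table)
    (e : N.ident r = y.1) (h : (N.ident r, N.wdist r u) ∈ (N.run S t u).cands) :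
    y = (N.ident r, N.wdist r u) := by
  have hy' := Finset.mem_filter.1 hy
  obtain ⟨r', -, e', hle⟩ := exists_of_mem_cands t u hy'.1
  obtain rfl := N.ident_injective (e'.trans e.symm)
  exact Prod.ext e.symm (le_antisymm (hy'.2 _ h e) hle)

/-- Wrong entries only overestimate. One standing before `r` would belong to a source that truly
stands before `r`, and that source already has its correct entry. -/
theorem rank_eq_trueRank {t : ℕ} {u r : V}
    (h : ∀ r' ∈ S, key (N.ident r', N.wdist r' u) ≤ key (N.ident r, N.wdist r u) →
      (N.ident r', N.wdist r' u) ∈ (N.run S t u).cands) :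
    (N.run S t u).rank (N.ident r, N.wdist r u) = N.trueRank S u r := by
  have hinj : Function.Injective fun r' => (N.ident r', N.wdist r' u) := fun _ _ e =>
    N.ident_injective (Prod.ext_iff.1 e).1
  rw [rank, trueRank, ← Finset.card_image_of_injective _ hinj]
  congr 1
  ext y
  simp only [Finset.mem_filter, Finset.mem_image]
  constructor
  · rintro ⟨hy, hle⟩
    obtain ⟨r', hr', e, hd⟩ := exists_of_mem_cands t u (Finset.mem_filter.1 hy).1
    have hle' : key (N.ident r', N.wdist r' u) ≤ key (N.ident r, N.wdist r u) := by
      refine (key_le_of_snd_le hd).trans ?_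
      rwa [e]
    exact ⟨r', ⟨hr', hle'⟩, (eq_of_mem_table hy e (h r' hr' hle')).symm⟩
  · rintro ⟨r', ⟨hr', hle⟩, rfl⟩
    exact ⟨mem_table_of_mem_cands (h r' hr' hle), hle⟩

omit [Fintype V] in
theorem trueRank_le_of_key_le {u r r' : V}
    (h : key (N.ident r', N.wdist r' u) ≤ key (N.ident r, N.wdist r u)) :
    N.trueRank S u r' ≤ N.trueRank S u r :=
  Finset.card_le_card fun _ hx => Finset.mem_filter.2
    ⟨(Finset.mem_filter.1 hx).1, (Finset.mem_filter.1 hx).2.trans h⟩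

omit [Fintype V] in
-- Going from `v` to `u`, the distance of `r` grows by exactly the weight and that of any other
-- source by at most as much, so sources ahead of `r` at `v` stay ahead at `u`.
theorem trueRank_le_of_adj {u v r : V} (hv : N.graph.Adj v u)
    (e : N.wdist r v + N.weight s(v, u) = N.wdist r u) :
    N.trueRank S v r ≤ N.trueRank S u r :=
  Finset.card_le_card fun r' hx => Finset.mem_filter.2 ⟨(Finset.mem_filter.1 hx).1,
    e ▸ key_le_add (Finset.mem_filter.1 hx).2 (N.wdist_le_add_weight r' hv)⟩

omit [Fintype V] in
theorem trueRank_le_card (u r : V) : N.trueRank S u r ≤ S.card :=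
  Finset.card_filter_le _ _

theorem ident_zero_mem_cands (t : ℕ) {u : V} (hu : u ∈ S) :
    (N.ident u, 0) ∈ (N.run S t u).cands := by
  induction t with
  | zero => simp [run, start, view, hu]
  | succ t ih => exact mem_cands_succ.2 (Or.inl ih)

/-- The pipelining argument: `v` sends its correct entry for `r` in round `wdist r v + trueRank`,
because by then it also holds every entry ahead of `r` and so computes the true rank. -/
theorem mem_cands_of_adj (t : ℕ) {u v r : V} (hr : r ∈ S) (hv : N.graph.Adj v u)
    (ht : N.wdist r v + N.trueRank S v r < t) :
    (N.ident r, N.wdist r v + N.weight s(v, u)) ∈ (N.run S t u).cands := by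
  induction t generalizing u v r with
  | zero => omega
  | succ t ih =>
    rcases Nat.lt_or_ge (N.wdist r v + N.trueRank S v r) t with h | h
    · exact mem_cands_succ.2 (Or.inl (ih hr hv h))
    · have hknown : ∀ r' ∈ S, N.wdist r' v + N.trueRank S v r' ≤ t →
          (N.ident r', N.wdist r' v) ∈ (N.run S t v).cands := by
        intro r' hr' hle
        rcases eq_or_ne r' v with rfl | hne
        · simpa using ident_zero_mem_cands t hr'
        -- The positive weight of the last edge pays for the round that the message takes.
        · obtain ⟨w, hw, e⟩ := N.exists_adj_wdist_add_weight hne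
          have := N.weight_pos_of_adj hw
          have := trueRank_le_of_adj (S := S) hw e
          exact e ▸ ih hr' hw (by omega)
      refine mem_cands_succ.2 (Or.inr ⟨v, hv, (N.ident r, N.wdist r v), sentEntry_eq ?_, rfl⟩)
      refine Finset.mem_filter.2
        ⟨mem_table_of_mem_cands (hknown r hr (by omega)), ?_⟩
      rw [run_time, rank_eq_trueRank fun r' hr' hle => hknown r' hr' ?_]
      · exact Nat.le_antisymm (by simpa using Nat.le_of_lt_succ ht) h
      · have := trueRank_le_of_key_le (S := S) hle
        have : N.wdist r' v ≤ N.wdist r v := snd_le_of_key_le hle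
        omega

theorem mem_cands (t : ℕ) {u r : V} (hr : r ∈ S) (ht : N.wdist r u + N.trueRank S u r ≤ t) :
    (N.ident r, N.wdist r u) ∈ (N.run S t u).cands := by
  rcases eq_or_ne r u with rfl | hne
  · simpa using ident_zero_mem_cands t hr
  · obtain ⟨w, hw, e⟩ := N.exists_adj_wdist_add_weight hne
    have := N.weight_pos_of_adj hw
    have := trueRank_le_of_adj (S := S) hw e
    exact e ▸ mem_cands_of_adj t hr hw (by omega)

theorem image_fst_cands_subset (t : ℕ) (u : V) :
    (N.run S t u).cands.image Prod.fst ⊆ S.image N.ident := by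
  intro i hi
  obtain ⟨x, hx, rfl⟩ := Finset.mem_image.1 hi
  obtain ⟨r, hr, e, -⟩ := exists_of_mem_cands t u hx
  exact Finset.mem_image.2 ⟨r, hr, e⟩

theorem card_image_fst_cands_le (t : ℕ) (u : V) :
    ((N.run S t u).cands.image Prod.fst).card ≤ S.card :=
  (Finset.card_le_card (image_fst_cands_subset t u)).trans Finset.card_image_le

/-- A node that knows fewer sources than the elapsed time permits knows all of them. -/
theorem card_le_of_card_image_fst_cands {t D : ℕ} {u : V} (hD : ∀ r, N.wdist r u ≤ D)
    (h : D + ((N.run S t u).cands.image Prod.fst).card < t) :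
    S.card ≤ ((N.run S t u).cands.image Prod.fst).card := by
  by_contra hlt
  have hex : (S.filter fun r => N.ident r ∉ (N.run S t u).cands.image Prod.fst).Nonempty := by
    by_contra hne
    rw [Finset.not_nonempty_iff_eq_empty, Finset.filter_eq_empty_iff] at hne
    apply hlt
    rw [← Finset.card_image_of_injective S N.ident_injective]
    refine Finset.card_le_card fun i hi => ?_
    obtain ⟨r, hr, rfl⟩ := Finset.mem_image.1 hi
    exact not_not.1 (hne hr)
  -- All sources ahead of the first missing one are known, so its rank is at most one more than the
  -- number known, and it is overdue.
  obtain ⟨r, hr, hmin⟩ := Finset.exists_min_image _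
    (fun r => key (N.ident r, N.wdist r u)) hex
  obtain ⟨hrS, hrn⟩ := Finset.mem_filter.1 hr
  have hrank : N.trueRank S u r ≤ ((N.run S t u).cands.image Prod.fst).card + 1 := by
    rw [← Finset.card_insert_of_notMem hrn, trueRank,
      ← Finset.card_image_of_injective _ N.ident_injective]
    refine Finset.card_le_card fun i hi => ?_
    obtain ⟨r', hr', rfl⟩ := Finset.mem_image.1 hi
    obtain ⟨hS', hle⟩ := Finset.mem_filter.1 hr'
    rw [Finset.mem_insert, or_iff_not_imp_right]
    intro hn
    have := key_injective (le_antisymm hle (hmin r' (Finset.mem_filter.2 ⟨hS', hn⟩)))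
    exact (Prod.ext_iff.1 this).1
  have := hD r
  exact hrn (Finset.mem_image.2 ⟨_, mem_cands t hrS (by omega), rfl⟩)

theorem table_eq_distTable {t : ℕ} {u : V}
    (h : ∀ r ∈ S, (N.ident r, N.wdist r u) ∈ (N.run S t u).cands) :
    (N.run S t u).table = N.distTable S u := by
  ext y
  rw [distTable, Finset.mem_image]
  constructor
  · intro hy
    obtain ⟨r, hr, e, -⟩ := exists_of_mem_cands t u (Finset.mem_filter.1 hy).1
    exact ⟨r, hr, (eq_of_mem_table hy e (h r hr)).symm⟩
  · rintro ⟨r, hr, rfl⟩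
    exact mem_table_of_mem_cands (h r hr)

end Pipeline

/-! ### Termination -/

section Termination

variable {l : V} (hl : N.ident l = sInf (Set.range N.ident))

variable (N S) in
/-- The round in which all nodes halt. -/
noncomputable def haltTime (l : V) : ℕ :=
  max (3 * N.wecc l + 1) (2 * N.wecc l + S.card + 1)

theorem haltTime_le (hn : 2 ≤ Fintype.card V) (l : V) :
    N.haltTime S l ≤ 4 * (S.card + N.wdiam) := by
  have := N.wdiam_pos hn
  have := N.wecc_le_wdiam l
  unfold haltTime
  omega

include hl

/-- Passing both tests forces the true eccentricity and all of `|S|` into the inequalities, hence `t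
≥ haltTime`. -/
theorem result_eq_none {t : ℕ} (ht : t < N.haltTime S l) (u : V) :
    (N.run S t u).result = none := by
  rw [result, if_neg]
  rintro ⟨h1, h2⟩
  rw [run_time] at h1 h2
  have e := alarm_eq_wecc_of_le hl h1
  rw [e] at h1 h2
  have := card_le_of_card_image_fst_cands (fun r => N.wdist_le_two_mul_wecc l r u) h2
  unfold haltTime at ht
  omega

theorem result_haltTime (u : V) :
    (N.run S (N.haltTime S l) u).result = some (N.distTable S u) := by
  have h1 : 3 * N.wecc l + 1 ≤ N.haltTime S l := le_max_left _ _
  have h2 : 2 * N.wecc l + S.card + 1 ≤ N.haltTime S l := le_max_right _ _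
  have h3 := card_image_fst_cands_le (N := N) (S := S) (N.haltTime S l) u
  rw [result, if_pos, table_eq_distTable]
  · intro r hr
    have := N.wdist_le_two_mul_wecc l r u
    have := N.trueRank_le_card (S := S) u r
    exact mem_cands _ hr (by omega)
  · rw [run_time, alarm_eq_wecc hl h1]
    omega

theorem config_eq_run_of_le {t : ℕ} (ht : t ≤ N.haltTime S l) :
    waveAlgorithm.config N S t = N.run S t :=
  config_eq_run (fun _ hs v => result_eq_none hl hs v) t ht

theorem output_config_haltTime (u : V) :
    waveAlgorithm.output (waveAlgorithm.config N S (N.haltTime S l) u) =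
      some (N.distTable S u) := by
  rw [config_eq_run_of_le hl le_rfl]
  exact result_haltTime hl u

theorem config_eq_of_haltTime_le {t : ℕ} (ht : N.haltTime S l ≤ t) :
    waveAlgorithm.config N S t = waveAlgorithm.config N S (N.haltTime S l) := by
  induction t, ht using Nat.le_induction with
  | base => rfl
  | succ t _ ih =>
    have e : waveAlgorithm.config N S (t + 1) =
        waveAlgorithm.step N (waveAlgorithm.config N S t) :=
      Function.iterate_succ_apply' _ _ _
    rw [e, ih]
    funext v
    exact if_neg (by rw [output_config_haltTime hl]; simp)

theorem eq_encode_of_message {t m : ℕ} {u v : V}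
    (h : waveAlgorithm.message N (waveAlgorithm.config N S t) u v = some m) :
    t < N.haltTime S l ∧ m = Encodable.encode (N.run S t u).msg := by
  unfold CongestAlgorithm.message at h
  split_ifs at h with hc
  have ht : t < N.haltTime S l := by
    by_contra hge
    have := hc.2
    rw [config_eq_of_haltTime_le hl (not_lt.1 hge), output_config_haltTime hl] at this
    simp at this
  rw [config_eq_run_of_le hl ht.le] at h
  exact ⟨ht, (Option.some.inj h).symm⟩

end Termination

end Network

/-! ### Concentration for random samples -/

section SampleProb

variable {V : Type*} [Fintype V]

theorem sampleProb_mono {p : ℝ} (h0 : 0 ≤ p) (h1 : p ≤ 1) {E F : Finset V → Prop}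
    (h : ∀ S, E S → F S) : sampleProb p E ≤ sampleProb p F := by
  classical
  refine Finset.sum_le_sum_of_subset_of_nonneg (fun S hS => ?_) fun _ _ _ =>
    mul_nonneg (pow_nonneg h0 _) (pow_nonneg (sub_nonneg.2 h1) _)
  simp only [Finset.mem_filter, Finset.mem_univ, true_and] at hS ⊢
  exact h S hS

/-- Independence, as the expansion of a product of binomials over subsets. -/
theorem sum_sample_mul_prod (p : ℝ) (f : V → ℝ) :
    ∑ S : Finset V, p ^ S.card * (1 - p) ^ (Fintype.card V - S.card) * ∏ r ∈ S, f r =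
      ∏ r : V, (p * f r + (1 - p)) := by
  classical
  rw [Finset.prod_add, Finset.powerset_univ]
  refine Finset.sum_congr rfl fun S _ => ?_
  rw [Finset.prod_mul_distrib, Finset.prod_const, Finset.prod_const, ← Finset.compl_eq_univ_sdiff,
    Finset.card_compl]
  ring

theorem sampleProb_add_not (p : ℝ) (E : Finset V → Prop) :
    sampleProb p E + sampleProb p (fun S => ¬ E S) = 1 := by
  classical
  have h := sum_sample_mul_prod (V := V) p fun _ => 1
  simp only [Finset.prod_const_one, mul_one, add_sub_cancel, Finset.prod_const_one] at h
  rw [← h, ← Finset.sum_filter_add_sum_filter_not Finset.univ E]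
  unfold sampleProb
  congr!

theorem sampleProb_or_le {p : ℝ} (h0 : 0 ≤ p) (h1 : p ≤ 1) (E F : Finset V → Prop) :
    sampleProb p (fun S => E S ∨ F S) ≤ sampleProb p E + sampleProb p F := by
  classical
  have hw : ∀ S : Finset V, 0 ≤ p ^ S.card * (1 - p) ^ (Fintype.card V - S.card) := fun _ =>
    mul_nonneg (pow_nonneg h0 _) (pow_nonneg (sub_nonneg.2 h1) _)
  simp only [sampleProb, Finset.sum_filter, ← Finset.sum_add_distrib]
  refine Finset.sum_le_sum fun S _ => ?_
  have := hw S
  by_cases hE : E S <;> by_cases hF : F S <;> simp [hE, hF, this]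

theorem sampleProb_exists_le {p : ℝ} (h0 : 0 ≤ p) (h1 : p ≤ 1) {ι : Type*} (s : Finset ι)
    (E : ι → Finset V → Prop) :
    sampleProb p (fun S => ∃ i ∈ s, E i S) ≤ ∑ i ∈ s, sampleProb p (E i) := by
  classical
  induction s using Finset.induction_on with
  | empty => simp [sampleProb]
  | insert i s hi ih =>
    rw [Finset.sum_insert hi]
    simp only [Finset.mem_insert, exists_eq_or_imp]
    exact (sampleProb_or_le h0 h1 _ _).trans (by gcongr)

/-- The full set carries all the mass, with `0 ^ 0 = 1`. -/
theorem sampleProb_one {E : Finset V → Prop} (h : E Finset.univ) : 1 ≤ sampleProb 1 E := by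
  classical
  unfold sampleProb
  refine le_trans ?_ (Finset.single_le_sum (f := fun S : Finset V =>
    (1 : ℝ) ^ S.card * (1 - 1) ^ (Fintype.card V - S.card)) (fun S _ => by simp) (a := Finset.univ)
    (by simpa using h))
  simp

theorem Real.exp_le_one_add_add_sq {x : ℝ} (h : |x| ≤ 1) : Real.exp x ≤ 1 + x + x ^ 2 := by
  have := (abs_le.1 (Real.abs_exp_sub_one_sub_id_le h)).2
  linarith

/-- An exponential moment bound for sums over a random sample. -/
theorem sampleProb_le_sum_le {p : ℝ} (h0 : 0 ≤ p) (h1 : p ≤ 1) (y : V → ℝ)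
    (hy : ∀ r, |y r| ≤ 1) (θ : ℝ) :
    sampleProb p (fun S => θ ≤ ∑ r ∈ S, y r) ≤
      Real.exp (p * (∑ r, y r + ∑ r, y r ^ 2) - θ) := by
  classical
  have hw : ∀ S : Finset V, 0 ≤ p ^ S.card * (1 - p) ^ (Fintype.card V - S.card) := fun _ =>
    mul_nonneg (pow_nonneg h0 _) (pow_nonneg (sub_nonneg.2 h1) _)
  -- Markov's inequality: the indicator of the event is at most `exp (∑ y - θ)`.
  have hmarkov : sampleProb p (fun S => θ ≤ ∑ r ∈ S, y r) ≤
      ∑ S : Finset V, p ^ S.card * (1 - p) ^ (Fintype.card V - S.card) *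
        (Real.exp (∑ r ∈ S, y r) * Real.exp (-θ)) := by
    refine (Finset.sum_le_sum fun S hS => ?_).trans (Finset.sum_le_sum_of_subset_of_nonneg
      (Finset.filter_subset _ _) fun S _ _ => mul_nonneg (hw S) (by positivity))
    refine le_mul_of_one_le_right (hw S) ?_
    rw [← Real.exp_add]
    have := (Finset.mem_filter.1 hS).2
    exact Real.one_le_exp (by linarith)
  have hprod : ∏ r : V, (p * Real.exp (y r) + (1 - p)) ≤
      ∏ r : V, Real.exp (p * (y r + y r ^ 2)) := by
    refine Finset.prod_le_prod (fun r _ => ?_) fun r _ => ?_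
    · have := mul_nonneg h0 (Real.exp_pos (y r)).le
      linarith
    · refine le_trans ?_ (Real.add_one_le_exp _)
      have := mul_le_mul_of_nonneg_left (Real.exp_le_one_add_add_sq (hy r)) h0
      linarith
  refine hmarkov.trans ?_
  simp only [← mul_assoc, ← Finset.sum_mul, Real.exp_sum]
  rw [sum_sample_mul_prod, sub_eq_add_neg _ θ, Real.exp_add]
  refine mul_le_mul_of_nonneg_right (hprod.trans_eq ?_) (Real.exp_pos _).le
  rw [← Real.exp_sum, ← Finset.mul_sum, Finset.sum_add_distrib]

theorem sampleProb_card_lt_le {p : ℝ} (h0 : 0 ≤ p) (h1 : p ≤ 1) :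
    sampleProb p (fun S : Finset V => (S.card : ℝ) < p * Fintype.card V / 2) ≤
      Real.exp (-(p * Fintype.card V / 16)) := by
  -- With mean `μ`, the exponent is `μ * (-1/4 + 1/16) + μ/8 = -μ/16`.
  have h := sampleProb_le_sum_le h0 h1 (fun _ : V => (-1 / 4 : ℝ))
    (fun _ => by norm_num [abs_le]) (-(p * Fintype.card V / 8))
  refine (sampleProb_mono h0 h1 fun S hS => ?_).trans (h.trans_eq ?_)
  · simp only [Finset.sum_const, nsmul_eq_mul]
    linarith
  · congr 1
    simp only [Finset.sum_const, nsmul_eq_mul, Finset.card_univ]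
    ring

theorem sampleProb_lt_card_le {p : ℝ} (h0 : 0 ≤ p) (h1 : p ≤ 1) :
    sampleProb p (fun S : Finset V => 2 * (p * Fintype.card V) < S.card) ≤
      Real.exp (-(p * Fintype.card V / 4)) := by
  have h := sampleProb_le_sum_le h0 h1 (fun _ : V => (1 / 2 : ℝ))
    (fun _ => by norm_num [abs_le]) (p * Fintype.card V)
  refine (sampleProb_mono h0 h1 fun S hS => ?_).trans (h.trans_eq ?_)
  · simp only [Finset.sum_const, nsmul_eq_mul]
    linarith
  · congr 1
    simp only [Finset.sum_const, nsmul_eq_mul, Finset.card_univ]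
    ring

theorem sampleProb_lt_sum_le {p : ℝ} (h0 : 0 ≤ p) (h1 : p ≤ 1) {ε D : ℝ} (hε : 0 < ε)
    (hε1 : ε ≤ 1) (hD : 0 < D) (x : V → ℝ) (hx : ∀ r, |x r| ≤ D) (hsum : ∑ r, x r = 0) :
    sampleProb p (fun S : Finset V => ε * D * (p * Fintype.card V) / 4 < ∑ r ∈ S, x r) ≤
      Real.exp (-(p * Fintype.card V * ε ^ 2 / 64)) := by
  -- With this scaling the linear term vanishes by centring, the squares contribute at most `μ * ε²
  -- / 64`, and the threshold is `μ * ε² / 32`.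
  have hlam : 0 < ε / (8 * D) := by positivity
  have h := sampleProb_le_sum_le h0 h1 (fun r => ε / (8 * D) * x r) (fun r => by
    rw [abs_mul, abs_of_pos hlam]
    calc ε / (8 * D) * |x r| ≤ ε / (8 * D) * D := by gcongr; exact hx r
      _ = ε / 8 := by field_simp
      _ ≤ 1 := by linarith) (p * Fintype.card V * ε ^ 2 / 32)
  refine (sampleProb_mono h0 h1 fun S hS => ?_).trans (h.trans ?_)
  · rw [← Finset.mul_sum]
    calc p * Fintype.card V * ε ^ 2 / 32
        = ε / (8 * D) * (ε * D * (p * Fintype.card V) / 4) := by field_simp; ring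
      _ ≤ _ := by gcongr
  · apply Real.exp_le_exp.2
    have hsq : ∑ r, (ε / (8 * D) * x r) ^ 2 ≤ Fintype.card V * (ε ^ 2 / 64) := by
      rw [← nsmul_eq_mul, ← Finset.card_univ]
      refine Finset.sum_le_card_nsmul _ _ _ fun r _ => ?_
      have hr : x r ^ 2 ≤ D ^ 2 := sq_le_sq' (abs_le.1 (hx r)).1 (abs_le.1 (hx r)).2
      calc (ε / (8 * D) * x r) ^ 2 = (ε / (8 * D)) ^ 2 * x r ^ 2 := by ring
        _ ≤ (ε / (8 * D)) ^ 2 * D ^ 2 := by gcongr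
        _ = ε ^ 2 / 64 := by field_simp; norm_num
    rw [← Finset.mul_sum, hsum]
    have := mul_le_mul_of_nonneg_left hsq h0
    linarith

/-- A random sample has about the expected size, and centred sums over it are small. -/
theorem sampleProb_concentration {p : ℝ} (h0 : 0 ≤ p) (h1 : p ≤ 1) {ε D : ℝ} (hε : 0 < ε)
    (hε1 : ε ≤ 1) (hD : 0 < D) (x : V → V → ℝ) (hx : ∀ u r, |x u r| ≤ D)
    (hsum : ∀ u, ∑ r, x u r = 0) :
    1 - (2 * Fintype.card V + 2) * Real.exp (-(p * Fintype.card V * ε ^ 2 / 64)) ≤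
      sampleProb p fun S : Finset V => p * Fintype.card V / 2 ≤ S.card ∧
        S.card ≤ 2 * (p * Fintype.card V) ∧
        ∀ u, |∑ r ∈ S, x u r| ≤ ε * D * (p * Fintype.card V) / 4 := by
  have hμ : 0 ≤ p * Fintype.card V := by positivity
  -- As `ε ≤ 1`, the tails of the sample size are bounded by the same exponential.
  have hμε : p * Fintype.card V * ε ^ 2 ≤ p * Fintype.card V :=
    mul_le_of_le_one_right hμ (pow_le_one₀ hε.le hε1)
  set q := Real.exp (-(p * Fintype.card V * ε ^ 2 / 64)) with hq
  have hlow := (sampleProb_card_lt_le (V := V) h0 h1).trans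
    (Real.exp_le_exp.2 (by linarith : _ ≤ -(p * Fintype.card V * ε ^ 2 / 64)))
  have hup := (sampleProb_lt_card_le (V := V) h0 h1).trans
    (Real.exp_le_exp.2 (by linarith : _ ≤ -(p * Fintype.card V * ε ^ 2 / 64)))
  have hpos := sampleProb_exists_le h0 h1 Finset.univ
    fun u S => ε * D * (p * Fintype.card V) / 4 < ∑ r ∈ S, x u r
  have hpos' := hpos.trans (Finset.sum_le_card_nsmul _ _ q fun u _ =>
    sampleProb_lt_sum_le h0 h1 hε hε1 hD (x u) (hx u) (hsum u))
  have hneg := sampleProb_exists_le h0 h1 Finset.univ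
    fun u S => ε * D * (p * Fintype.card V) / 4 < ∑ r ∈ S, -x u r
  have hneg' := hneg.trans (Finset.sum_le_card_nsmul _ _ q fun u _ =>
    sampleProb_lt_sum_le h0 h1 hε hε1 hD (fun r => -x u r) (fun r => by simpa using hx u r)
      (by simpa using hsum u))
  rw [nsmul_eq_mul, Finset.card_univ] at hpos' hneg'
  rw [sub_le_iff_le_add, ← sampleProb_add_not p fun S : Finset V =>
    p * Fintype.card V / 2 ≤ S.card ∧ S.card ≤ 2 * (p * Fintype.card V) ∧
      ∀ u, |∑ r ∈ S, x u r| ≤ ε * D * (p * Fintype.card V) / 4]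
  gcongr
  refine (sampleProb_mono h0 h1 (F := fun S => (S.card < p * Fintype.card V / 2 ∨
    2 * (p * Fintype.card V) < S.card) ∨
    ((∃ u ∈ Finset.univ, ε * D * (p * Fintype.card V) / 4 < ∑ r ∈ S, x u r) ∨
    ∃ u ∈ Finset.univ, ε * D * (p * Fintype.card V) / 4 < ∑ r ∈ S, -x u r)) fun S hS => ?_).trans ?_
  · contrapose! hS
    obtain ⟨⟨ha, hb⟩, hc, hd⟩ := hS
    refine ⟨ha, hb, fun u => abs_le'.2 ⟨hc u (Finset.mem_univ u), ?_⟩⟩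
    simpa using hd u (Finset.mem_univ u)
  · have e1 := sampleProb_or_le h0 h1
      (fun S : Finset V => (S.card < p * Fintype.card V / 2 ∨ 2 * (p * Fintype.card V) < S.card))
      (fun S => (∃ u ∈ Finset.univ, ε * D * (p * Fintype.card V) / 4 < ∑ r ∈ S, x u r) ∨
        ∃ u ∈ Finset.univ, ε * D * (p * Fintype.card V) / 4 < ∑ r ∈ S, -x u r)
    have e2 := sampleProb_or_le h0 h1 (fun S : Finset V => S.card < p * Fintype.card V / 2)
      (fun S => 2 * (p * Fintype.card V) < S.card)
    have e3 := sampleProb_or_le h0 h1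
      (fun S => ∃ u ∈ Finset.univ, ε * D * (p * Fintype.card V) / 4 < ∑ r ∈ S, x u r)
      (fun S => ∃ u ∈ Finset.univ, ε * D * (p * Fintype.card V) / 4 < ∑ r ∈ S, -x u r)
    linarith

end SampleProb

/-! ### Message length -/

/-- Each pairing at most squares the size, and three are nested, whence the eighth power. -/
theorem encode_message_le {X i d α : ℕ} {b : Bool} {e : Option (ℕ × ℕ)} (hX : 3 ≤ X)
    (hα : α ≤ X) (he : ∀ x ∈ e, x = (i, d)) (hi : i ≤ X) (hd : d ≤ X) :
    Encodable.encode (b, α, e) ≤ (2 * X) ^ 8 := by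
  have he' : Encodable.encode e ≤ (X + 1) ^ 2 := by
    rcases e with - | x
    · simp
    · rw [he x rfl, Encodable.encode_some, Encodable.encode_prod_val]
      refine (Nat.pair_lt_max_add_one_sq _ _).trans_le (Nat.pow_le_pow_left ?_ 2)
      simp [hi, hd]
  have h1 : X + 1 ≤ (X + 1) ^ 2 := Nat.le_self_pow (by norm_num) _
  have h2 : Encodable.encode (α, e) ≤ ((X + 1) ^ 2 + 1) ^ 2 := by
    rw [Encodable.encode_prod_val]
    refine (Nat.pair_lt_max_add_one_sq _ _).le.trans (Nat.pow_le_pow_left ?_ 2)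
    refine Nat.succ_le_succ (max_le ?_ he')
    simp only [Encodable.encode_nat]
    omega
  have h3 : Encodable.encode b ≤ ((X + 1) ^ 2 + 1) ^ 2 := by
    have : Encodable.encode b ≤ 1 := by cases b <;> simp
    exact this.trans (Nat.one_le_pow _ _ (Nat.succ_pos _))
  rw [Encodable.encode_prod_val]
  refine (Nat.pair_lt_max_add_one_sq _ _).le.trans ?_
  refine (Nat.pow_le_pow_left (Nat.succ_le_succ (max_le h3 h2)) 2).trans ?_
  have h4 : (X + 1) ^ 2 + 1 ≤ (X + 2) ^ 2 := by nlinarith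
  have h5 : ((X + 1) ^ 2 + 1) ^ 2 + 1 ≤ (X + 3) ^ 4 := by
    calc ((X + 1) ^ 2 + 1) ^ 2 + 1 ≤ ((X + 2) ^ 2) ^ 2 + 1 := by gcongr
      _ = (X + 2) ^ 4 + 1 := by ring
      _ ≤ (X + 3) ^ 4 := Nat.pow_lt_pow_left (by omega) (by norm_num)
  calc (((X + 1) ^ 2 + 1) ^ 2 + 1) ^ 2 ≤ ((X + 3) ^ 4) ^ 2 := by gcongr
    _ = (X + 3) ^ 8 := by ring
    _ ≤ (2 * X) ^ 8 := by gcongr; omega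

theorem Nat.size_le_one_add_log_div {m : ℕ} {y : ℝ} (hy : 1 ≤ y) (hm : (m : ℝ) ≤ y) :
    (m.size : ℝ) ≤ 1 + Real.log y / Real.log 2 := by
  rcases hs : m.size with - | k
  · have := Real.log_nonneg hy
    have := Real.log_pos one_lt_two
    push_cast
    positivity
  · have h : (2 : ℝ) ^ k ≤ y := by
      have : 2 ^ k ≤ m := Nat.lt_size.1 (by omega)
      exact le_trans (by exact_mod_cast this) hm
    have h' := Real.log_le_log (by positivity) h
    rw [Real.log_pow] at h'
    have := (le_div_iff₀ (Real.log_pos one_lt_two)).2 h'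
    push_cast
    linarith

namespace Network

open WaveState

variable {V : Type*} [Fintype V] (N : Network V)

theorem size_message_le (S : Finset V) (hn : 2 ≤ Fintype.card V) {κ : ℕ}
    (hid : ∀ v, N.ident v ≤ Fintype.card V ^ κ) {t m : ℕ} {u v : V}
    (h : waveAlgorithm.message N (waveAlgorithm.config N S t) u v = some m) :
    (m.size : ℝ) ≤ ((8 * κ + 41) / Real.log 2) *
      (Real.log (Fintype.card V) + Real.log N.wdiam) := by
  have : Nonempty V := ⟨u⟩
  obtain ⟨l, hl⟩ := N.exists_leader
  obtain ⟨ht, rfl⟩ := eq_encode_of_message hl h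
  set n := Fintype.card V with hnn
  have hD := N.wdiam_pos hn
  set D := N.wdiam
  have hpow : 0 < n ^ κ := Nat.pow_pos (by omega)
  have hnD : n * D ≤ n ^ (κ + 1) * D :=
    Nat.mul_le_mul_right _ (Nat.le_self_pow (Nat.succ_ne_zero κ) n)
  have hX : n + D ≤ 2 * (n ^ (κ + 1) * D) := by nlinarith
  have hXκ : n ^ κ ≤ n ^ (κ + 1) * D := by
    rw [pow_succ, mul_assoc]
    exact Nat.le_mul_of_pos_right _ (Nat.mul_pos (by omega) hD)
  have htX : t ≤ 8 * (n ^ (κ + 1) * D) := by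
    have := N.haltTime_le (S := S) hn l
    have : S.card ≤ n := S.card_le_univ
    omega
  have hα : (N.run S t u).sentAlarm ≤ 8 * (n ^ (κ + 1) * D) := by
    have := sentAlarm_le_wecc hl (S := S) t u
    have := N.wecc_le_wdiam l
    omega
  have henc : Encodable.encode (N.run S t u).msg ≤ (2 * (8 * (n ^ (κ + 1) * D))) ^ 8 := by
    rcases he : (N.run S t u).sentEntry with - | x
    · exact encode_message_le (i := 0) (d := 0) (by omega) hα (by simp [he]) (by omega) (by omega)
    · have hdue := Finset.mem_filter.1 (mem_due_of_sentEntry he)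
      obtain ⟨r, -, e, -⟩ := exists_of_mem_cands t u (Finset.mem_filter.1 hdue.1).1
      -- An entry is sent when its distance plus rank equals the time, so even an overestimated
      -- distance is at most `t`.
      have hx := hdue.2
      rw [run_time] at hx
      have := hid r
      refine encode_message_le (i := x.1) (d := x.2) (by omega) hα (fun y hy => ?_)
        (by omega) (by omega)
      rw [he] at hy
      exact (Option.some.inj hy).symm
  have hn0 : (0 : ℝ) < n := by exact_mod_cast (by omega : 0 < n)
  have hD0 : (0 : ℝ) < D := by exact_mod_cast hD
  have hsize := Nat.size_le_one_add_log_div (m := Encodable.encode (N.run S t u).msg)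
    (y := (2 * (8 * (n ^ (κ + 1) * D))) ^ 8)
    (by
      have : 1 ≤ (2 * (8 * (n ^ (κ + 1) * D))) ^ 8 := Nat.one_le_pow _ _ (by omega)
      exact_mod_cast this) (by exact_mod_cast henc)
  have hlog : Real.log ((2 * (8 * ((n : ℝ) ^ (κ + 1) * D))) ^ 8) =
      8 * (4 * Real.log 2 + ((κ + 1) * Real.log n + Real.log D)) := by
    rw [show (2 * (8 * ((n : ℝ) ^ (κ + 1) * D))) = 2 ^ 4 * ((n : ℝ) ^ (κ + 1) * D) by ring,
      Real.log_pow, Real.log_mul (by positivity) (by positivity), Real.log_pow,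
      Real.log_mul (by positivity) (by positivity), Real.log_pow]
    push_cast
    ring
  rw [hlog] at hsize
  have hlog2 := Real.log_pos one_lt_two
  have hlogn : Real.log 2 ≤ Real.log n :=
    Real.log_le_log two_pos (by exact_mod_cast hn)
  have hlogD : 0 ≤ Real.log D := Real.log_nonneg (by exact_mod_cast hD)
  refine hsize.trans ?_
  rw [div_mul_eq_mul_div, le_div_iff₀ hlog2, add_mul, div_mul_cancel₀ _ hlog2.ne']
  have hκ : (0 : ℝ) ≤ κ * Real.log D := by positivity
  nlinarith

/-! ### The closeness estimate -/

theorem one_div_closeness (u : V) :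
    1 / N.closeness u = (∑ r, (N.wdist r u : ℝ)) / ((Fintype.card V : ℝ) - 1) := by
  simp only [closeness, one_div_div, N.wdist_comm u]

omit [Fintype V] in
theorem one_div_ccEstimate (n : ℕ) (S : Finset V) (u : V) :
    1 / ccEstimate n (N.distTable S u) =
      n * (∑ r ∈ S, (N.wdist r u : ℝ)) / (S.card * ((n : ℝ) - 1)) := by
  rw [ccEstimate, one_div_one_div, ← Finset.sum_div, ← Finset.mul_sum, sum_distTable,
    card_distTable]

/-- The deviation of the distance to `r` from the average distance. -/
noncomputable def centredDist (u r : V) : ℝ :=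
  N.wdist r u - (∑ r', (N.wdist r' u : ℝ)) / Fintype.card V

theorem sum_centredDist (hn : 0 < Fintype.card V) (u : V) : ∑ r, N.centredDist u r = 0 := by
  have : (Fintype.card V : ℝ) ≠ 0 := by exact_mod_cast hn.ne'
  simp only [centredDist, Finset.sum_sub_distrib, Finset.sum_const, Finset.card_univ,
    nsmul_eq_mul]
  field_simp
  ring

theorem abs_centredDist_le (hn : 0 < Fintype.card V) (u r : V) :
    |N.centredDist u r| ≤ N.wdiam := by
  have h0 : (0 : ℝ) < Fintype.card V := by exact_mod_cast hn
  have h1 : (∑ r', (N.wdist r' u : ℝ)) / Fintype.card V ≤ N.wdiam := by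
    rw [div_le_iff₀ h0, mul_comm, ← nsmul_eq_mul, ← Finset.card_univ]
    exact Finset.sum_le_card_nsmul _ _ _ fun r' _ => by exact_mod_cast N.wdist_le_wdiam r' u
  have h2 : 0 ≤ (∑ r', (N.wdist r' u : ℝ)) / Fintype.card V := by positivity
  have h3 : (N.wdist r u : ℝ) ≤ N.wdiam := by exact_mod_cast N.wdist_le_wdiam r u
  have h4 : (0 : ℝ) ≤ N.wdist r u := by positivity
  rw [centredDist, abs_le]
  constructor <;> linarith

theorem abs_one_div_closeness_sub (hn : 2 ≤ Fintype.card V) {S : Finset V} (hS : S.Nonempty)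
    (u : V) :
    |1 / N.closeness u - 1 / ccEstimate (Fintype.card V) (N.distTable S u)| ≤
      2 * (|∑ r ∈ S, N.centredDist u r| / S.card) := by
  have h0 : (2 : ℝ) ≤ Fintype.card V := by exact_mod_cast hn
  have hc : (0 : ℝ) < S.card := by exact_mod_cast hS.card_pos
  have h1 : (0 : ℝ) < (Fintype.card V : ℝ) - 1 := by linarith
  have h2 : (0 : ℝ) < Fintype.card V := by linarith
  -- The sampled mean minus the true mean is the mean of the centred distances; the factor `n/(n-1)`
  -- is at most 2.
  have e : 1 / N.closeness u - 1 / ccEstimate (Fintype.card V) (N.distTable S u) =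
      -(Fintype.card V / ((Fintype.card V : ℝ) - 1) *
        ((∑ r ∈ S, N.centredDist u r) / S.card)) := by
    rw [one_div_closeness, one_div_ccEstimate]
    simp only [centredDist, Finset.sum_sub_distrib, Finset.sum_const, nsmul_eq_mul]
    field_simp
    ring
  rw [e, abs_neg, abs_mul, abs_div, abs_div, abs_of_pos h1, abs_of_pos h2, abs_of_pos hc]
  gcongr
  rw [div_le_iff₀ h1]
  linarith

variable {N} in
/-- If a sample has the right size and represents the distances well, then the algorithm is fast
and accurate. -/
theorem estimate_of_sample (hn : 2 ≤ Fintype.card V) {ε C M : ℝ} {S : Finset V}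
    (hS : S.Nonempty) (hC : 4 ≤ C) (hcard : 4 * S.card ≤ C * M)
    (herr : ∀ u, |∑ r ∈ S, N.centredDist u r| / S.card ≤ ε * N.wdiam / 2) :
    S.Nonempty ∧ (S.card : ℝ) ≤ C * M ∧ ∃ T : ℕ, (T : ℝ) ≤ C * (M + N.wdiam) ∧
      ∀ u : V, ∃ L : Finset (ℕ × ℕ), waveAlgorithm.output (waveAlgorithm.config N S T u) = some L ∧
        |1 / N.closeness u - 1 / ccEstimate (Fintype.card V) L| ≤ ε * N.wdiam := by
  have : Nonempty V := ⟨hS.choose⟩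
  obtain ⟨l, hl⟩ := N.exists_leader
  have hc : (0 : ℝ) ≤ S.card := by positivity
  refine ⟨hS, by linarith, N.haltTime S l, ?_, fun u => ⟨_, output_config_haltTime hl u, ?_⟩⟩
  · have hT : (N.haltTime S l : ℝ) ≤ 4 * (S.card + N.wdiam) := by
      exact_mod_cast N.haltTime_le hn l
    have : 4 * (N.wdiam : ℝ) ≤ C * N.wdiam := by gcongr
    linarith
  · have := N.abs_one_div_closeness_sub hn hS u
    have := herr u
    linarith

end Network

theorem two_mul_add_two_mul_exp_le {n : ℕ} (hn : 2 ≤ n) {a c : ℝ} (hc : 64 * (a + 3) ≤ c) :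
    (2 * (n : ℝ) + 2) * Real.exp (-(c * Real.log n / 64)) ≤ (n : ℝ) ^ (-a) := by
  have h2 : (2 : ℝ) ≤ n := by exact_mod_cast hn
  have hlog : 0 ≤ Real.log n := Real.log_nonneg (by linarith)
  -- The union bound costs at most `n ^ 3`, which the 3 in `a + 3` pays for.
  have h3 : 2 * (n : ℝ) + 2 ≤ (n : ℝ) ^ 3 := by nlinarith [sq_nonneg (n : ℝ)]
  calc (2 * (n : ℝ) + 2) * Real.exp (-(c * Real.log n / 64))
      ≤ (n : ℝ) ^ 3 * Real.exp (-(a + 3) * Real.log n) := by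
        gcongr
        nlinarith
    _ = (n : ℝ) ^ (-a) := by
        rw [← Real.rpow_natCast, Real.rpow_def_of_pos (by linarith),
          Real.rpow_def_of_pos (by linarith), ← Real.exp_add]
        congr 1
        push_cast
        ring

/-- The analysis of the sampling step. -/
theorem sampleProb_estimate {V : Type*} [Fintype V] (N : Network V) {a c ε : ℝ} (ha : 0 < a)
    (hc : 64 * (a + 3) ≤ c) (hn : 2 ≤ Fintype.card V) (hε : 0 < ε) (hε1 : ε ≤ 1) :
    1 - (Fintype.card V : ℝ) ^ (-a) ≤
      sampleProb (joinProb c (Fintype.card V) ε) fun S : Finset V =>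
        S.Nonempty ∧
        (S.card : ℝ) ≤ (8 * c + 4) * (Real.log (Fintype.card V) / ε ^ 2) ∧
        ∃ T : ℕ,
          (T : ℝ) ≤ (8 * c + 4) * (Real.log (Fintype.card V) / ε ^ 2 + N.wdiam) ∧
          ∀ u : V, ∃ L : Finset (ℕ × ℕ),
            waveAlgorithm.output (waveAlgorithm.config N S T u) = some L ∧
            |1 / N.closeness u - 1 / ccEstimate (Fintype.card V) L| ≤ ε * N.wdiam := by
  have hn0 : 0 < Fintype.card V := by omega
  have h2 : (2 : ℝ) ≤ Fintype.card V := by exact_mod_cast hn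
  have hnpos : (0 : ℝ) < Fintype.card V := by linarith
  have hlog : 0 < Real.log (Fintype.card V) := Real.log_pos (by linarith)
  have hcpos : 0 < c := by linarith
  have hM : 0 < Real.log (Fintype.card V) / ε ^ 2 := by positivity
  have hD : (0 : ℝ) < N.wdiam := by exact_mod_cast N.wdiam_pos hn
  set M := Real.log (Fintype.card V) / ε ^ 2 with hMdef
  have hfrac : c * Real.log (Fintype.card V) / (Fintype.card V * ε ^ 2) =
      c * M / Fintype.card V := by
    rw [hMdef]
    field_simp
  rw [joinProb, hfrac]
  -- If the join probability is capped at 1, the sample is all of `V` and the centred sums vanish.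
  rcases le_total 1 (c * M / Fintype.card V) with hp | hp
  · rw [min_eq_left hp]
    rw [one_le_div hnpos] at hp
    have hsub : 1 - (Fintype.card V : ℝ) ^ (-a) ≤ 1 := by
      have : 0 ≤ (Fintype.card V : ℝ) ^ (-a) := by positivity
      linarith
    have : Nonempty V := Fintype.card_pos_iff.1 hn0
    refine hsub.trans (sampleProb_one (Network.estimate_of_sample hn Finset.univ_nonempty
      (by linarith) ?_ fun u => ?_))
    · rw [Finset.card_univ]
      nlinarith
    · rw [N.sum_centredDist hn0, abs_zero, zero_div]
      positivity
  · rw [min_eq_right hp]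
    have hp0 : 0 ≤ c * M / Fintype.card V := by positivity
    have hμ : c * M / Fintype.card V * Fintype.card V = c * M := div_mul_cancel₀ _ hnpos.ne'
    have hconc := sampleProb_concentration hp0 hp hε hε1 hD N.centredDist
      (N.abs_centredDist_le hn0) (N.sum_centredDist hn0)
    simp only [hμ] at hconc
    have hexp : c * M * ε ^ 2 = c * Real.log (Fintype.card V) := by
      rw [hMdef]
      field_simp
    rw [hexp] at hconc
    have htail := two_mul_add_two_mul_exp_le hn hc
    refine (by linarith : _ ≤ _).trans (hconc.trans (sampleProb_mono hp0 hp fun S hS => ?_))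
    obtain ⟨hlow, hup, hdev⟩ := hS
    have hcM : 0 < c * M := by positivity
    have hSpos : (0 : ℝ) < S.card := by linarith
    refine Network.estimate_of_sample hn (Finset.card_pos.1 (by exact_mod_cast hSpos))
      (by linarith) (by nlinarith) fun u => ?_
    rw [div_le_iff₀ hSpos]
    refine (hdev u).trans ?_
    calc ε * N.wdiam * (c * M) / 4 = ε * N.wdiam / 2 * (c * M / 2) := by ring
      _ ≤ ε * N.wdiam / 2 * S.card := by gcongr

theorem theorem4 :
    ∃ (A : CongestAlgorithm) (C₀ : ℝ),
      -- for every sample, all nodes halt knowing exactly their distances to the sampled nodes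
      (∀ (V : Type) [Fintype V] (N : Network V) (S : Finset V), 2 ≤ Fintype.card V →
        ∃ T : ℕ, (T : ℝ) ≤ C₀ * (S.card + N.wdiam) ∧
          ∀ u : V, A.output (A.config N S T u) = some (N.distTable S u)) ∧
      -- all messages are short
      (∀ κ : ℕ, ∃ B : ℝ, ∀ (V : Type) [Fintype V] (N : Network V) (S : Finset V),
        2 ≤ Fintype.card V → (∀ v, N.ident v ≤ Fintype.card V ^ κ) →
        ∀ (t : ℕ) (u v : V) (m : ℕ), A.message N (A.config N S t) u v = some m →
          (m.size : ℝ) ≤ B * (Real.log (Fintype.card V) + Real.log N.wdiam)) ∧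
      -- sample size, running time and approximation error, with high probability
      (∀ a : ℝ, 0 < a → ∃ c₀ : ℝ, 0 < c₀ ∧ ∀ c : ℝ, c₀ ≤ c → ∃ C : ℝ,
        ∀ (V : Type) [Fintype V] (N : Network V) (ε : ℝ),
          2 ≤ Fintype.card V → 0 < ε → ε ≤ 1 →
          1 - (Fintype.card V : ℝ) ^ (-a) ≤
            sampleProb (joinProb c (Fintype.card V) ε) fun S : Finset V =>
              S.Nonempty ∧
              (S.card : ℝ) ≤ C * (Real.log (Fintype.card V) / ε ^ 2) ∧
              ∃ T : ℕ,
                (T : ℝ) ≤ C * (Real.log (Fintype.card V) / ε ^ 2 + N.wdiam) ∧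
                ∀ u : V, ∃ L : Finset (ℕ × ℕ),
                  A.output (A.config N S T u) = some L ∧
                  |1 / N.closeness u - 1 / ccEstimate (Fintype.card V) L| ≤ ε * N.wdiam) := by
  refine ⟨waveAlgorithm, 4, fun V _ N S hn => ?_, fun κ => ⟨(8 * κ + 41) / Real.log 2, ?_⟩,
    -- The halting time is at most `4 * (|S| + D)`, and `|S| ≤ 2 * c * log n / ε²`; this gives `8 *
    -- c` for the sample and 4 for the diameter.
    fun a ha => ⟨64 * (a + 3), by linarith, fun c hc => ⟨8 * c + 4, ?_⟩⟩⟩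
  · have : Nonempty V := Fintype.card_pos_iff.1 (by omega)
    obtain ⟨l, hl⟩ := N.exists_leader
    exact ⟨N.haltTime S l, by exact_mod_cast N.haltTime_le hn l,
      Network.output_config_haltTime hl⟩
  · exact fun V _ N S hn hid t u v m h => N.size_message_le S hn hid h
  · exact fun V _ N ε hn hε hε1 => sampleProb_estimate N ha hc hn hε hε1
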